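/- Let $n\ge 2$ and $m\ge 1$. In $V=\{v\in\mathbb R^n:\sum_i v_i=0\}$ put $\alpha_{ij}=\varepsilon_i-\varepsilon_{j+1}$ for $1\le i\le j\le n-1$ (the positive roots of type $A_{n-1}$), $\theta=\alpha_{1,n-1}$, and $H_{\alpha,k}=\{v\in V:\langle v,\alpha\rangle=k\}$. The $m$-Shi arrangement is the set of all $H_{\alpha_{ij},k}$ with $-m<k\le m$; its regions are the connected components of the complement in $V$ of the union of its hyperplanes, and a region is dominant if $\langle v,\alpha_{ii}\rangle\ge 0$ on it for all $i$. Alcoves are the connected components of the complement of the union of all $H_{\alpha_{ij},k}$, $k\in\mathbb Z$, and $\mathcal A_0$ is the alcove $\{v\in V:\langle v,\theta\rangle<1,\ \langle v,\alpha_{ii}\rangle>0 \text{ for all } i\}$. The $m$-minimal alcove of a region $R$ is the alcove contained in $R$ that is closest to $\mathcal A_0$, i.e. separated from $\mathcal A_0$ by the fewest hyperplanes $H_{\alpha_{ij},k}$, $k\in\mathbb Z$. A separating wall of $R$ is a hyperplane of the $m$-Shi arrangement that supports a facet of $R$ and separates $R$ from $\mathcal A_0$. Define $$r(R)=\bigl|\{(j,k):1\le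 j\le n-1,\ 1\le k\le m,\ H_{\alpha_{1j},k}\text{ separates }R\text{ from }\mathcal A_0\}\bigr|,$$ $$c(R)=\bigl|\{(i,k):1\le i\le n-1,\ 1\le k\le m,\ H_{\alpha_{i,n-1},k}\text{ separates }R\text{ from }\mathcal A_0\}\bigr|.$$ Let $\lambda$ be an $n$-core, that is, a partition none of whose hook lengths is divisible by $n$. Let its beads be the negative integers and the hook lengths of the boxes in its first column. For $0\le i\le n-1$ let the level number $b_i$ be one more than the largest $q\in\mathbb Z$ such that $qn+i$ is a bead. Let $p_1<\dots<p_n$ be the numbers $b_i n+i$ $(0\le i\le n-1)$ in ascending order, and let $\Psi(\lambda)$ be the alcove $$\Psi(\lambda)=\{x\in V: k_{ij}<\langle x,\alpha_{ij}\rangle<k_{ij}+1 \text{ for } 1\le i\le j\le n-1\},\qquad k_{ij}=\Bigl\lfloor \frac{p_{j+1}-p_i}{n}\Bigr\rfloor .$$ Suppose that $R$ is a dominant region of the $m$-Shi arrangement which has $H_{\theta,m}$ as a separating wall, and that $\Psi(\lambda)$ is the $m$-minimal alcove of $R$. Then $$r(R)=m+\sum_{i=2}^{n-1}b_i=\ell(\lambda)\qquad\text{and}\qquad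 c(R)=m+\sum_{i=2}^{n-1}(m-1-b_i)=\lambda_1,$$ where $\ell(\lambda)$ is the number of positive parts of $\lambda$ and $\lambda_1$ is its largest part. -/

import Mathlib

noncomputable section

namespace Shi

/-! ### Partitions, hooks, cores, abaci

A partition is a `YoungDiagram`; its boxes are indexed from `0`, so the first row is row `0`
and the first column is column `0`. -/

/-- The hook of the box `(k, l)`: the box itself, the boxes of row `k` to its right and the boxes
of column `l` below it. -/
def hook (lam : YoungDiagram) (k l : ℕ) : Finset (ℕ × ℕ) :=
  lam.cells.filter fun c => (c.1 = k ∧ l ≤ c.2) ∨ (c.2 = l ∧ k ≤ c.1)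

/-- The hook length of the box `(k, l)`. -/
def hookLength (lam : YoungDiagram) (k l : ℕ) : ℕ := (hook lam k l).card

/-- `lam` is an `n`-core: no hook length is divisible by `n`. -/
def IsCore (n : ℕ) (lam : YoungDiagram) : Prop :=
  ∀ k l : ℕ, (k, l) ∈ lam → ¬ n ∣ hookLength lam k l

/-- The length of a partition: its number of positive parts. -/
def length (lam : YoungDiagram) : ℕ := lam.rowLens.length

/-- The largest part of a partition (`0` for the empty partition). -/
def firstPart (lam : YoungDiagram) : ℕ := lam.rowLen 0

/-- The entries carrying a bead in the original abacus of `lam`: the negative integers and the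
hook lengths of the boxes in the first column. -/
def beads (lam : YoungDiagram) : Set ℤ :=
  {z | z < 0 ∨ ∃ k : ℕ, (k, 0) ∈ lam ∧ z = hookLength lam k 0}

/-- The level number `b_i`: one more than the largest level of a bead on runner `i` of the
`n`-abacus; the entry on level `q` of runner `i` is `q * n + i`. -/
def levelNumber (n : ℕ) (lam : YoungDiagram) (i : ℕ) : ℤ :=
  sSup {q : ℤ | q * n + i ∈ beads lam} + 1

/-- The entry of the first gap on runner `t`, for `t = 0, …, n - 1`. -/
def gapEntry (n : ℕ) (lam : YoungDiagram) (t : Fin n) : ℤ :=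
  levelNumber n lam t * n + t

/-- `sortedGap n lam i` is `p_i`, for `i = 1, …, n`, where `p_1 < ⋯ < p_n` are the first-gap
entries in ascending order. -/
def sortedGap (n : ℕ) (lam : YoungDiagram) (i : ℕ) : ℤ :=
  if h : i - 1 < n then gapEntry n lam (Tuple.sort (gapEntry n lam) ⟨i - 1, h⟩) else 0

/-- The numbers `k_{ij} = ⌊(p_{j+1} - p_i) / n⌋`, for `1 ≤ i ≤ j ≤ n - 1`. -/
def coreCoord (n : ℕ) (lam : YoungDiagram) (i j : ℕ) : ℤ :=
  ⌊((sortedGap n lam (j + 1) - sortedGap n lam i : ℤ) : ℝ) / (n : ℝ)⌋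

/-! ### The root system of type `A_{n-1}` -/

/-- The standard basis vector `ε_i` of `ℝⁿ`, for `1 ≤ i ≤ n`. -/
def eps (n i : ℕ) : EuclideanSpace ℝ (Fin n) :=
  WithLp.toLp 2 fun t => if (t : ℕ) + 1 = i then 1 else 0

/-- The space of vectors of `ℝⁿ` with coordinate sum zero. -/
def V (n : ℕ) : Submodule ℝ (EuclideanSpace ℝ (Fin n)) where
  carrier := {v | ∑ t, v t = 0}
  zero_mem' := by simp
  add_mem' := by
    intro a b ha hb
    simp only [Set.mem_ofPred_eq] at ha hb ⊢
    simp [Finset.sum_add_distrib, ha, hb]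
  smul_mem' := by
    intro c a ha
    simp only [Set.mem_ofPred_eq] at ha ⊢
    simp [← Finset.mul_sum, ha]

/-- The root `α_{ij} = α_i + ⋯ + α_j = ε_i - ε_{j+1}`, for `1 ≤ i ≤ j ≤ n - 1`. -/
def root (n i j : ℕ) : EuclideanSpace ℝ (Fin n) := eps n i - eps n (j + 1)

/-- The highest root `θ = α_{1,n-1}`. -/
def theta (n : ℕ) : EuclideanSpace ℝ (Fin n) := root n 1 (n - 1)

/-- The positive roots. -/
def posRoots (n : ℕ) : Set (EuclideanSpace ℝ (Fin n)) :=
  {α | ∃ i j : ℕ, 1 ≤ i ∧ i ≤ j ∧ j < n ∧ α = root n i j}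

/-! ### Hyperplanes, regions, alcoves -/

/-- The hyperplane `H_{α,k}` of `V`. -/
def hyperplane {n : ℕ} (α : EuclideanSpace ℝ (Fin n)) (k : ℤ) : Set (V n) :=
  {v | inner ℝ (v : EuclideanSpace ℝ (Fin n)) α = (k : ℝ)}

/-- The closed half-space of `V` given by `⟨v, α⟩ ≥ k`. -/
def upperHalf {n : ℕ} (α : EuclideanSpace ℝ (Fin n)) (k : ℤ) : Set (V n) :=
  {v | (k : ℝ) ≤ inner ℝ (v : EuclideanSpace ℝ (Fin n)) α}

/-- The closed half-space of `V` given by `⟨v, α⟩ ≤ k`. -/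
def lowerHalf {n : ℕ} (α : EuclideanSpace ℝ (Fin n)) (k : ℤ) : Set (V n) :=
  {v | inner ℝ (v : EuclideanSpace ℝ (Fin n)) α ≤ (k : ℝ)}

/-- `H_{α,k}` separates `A` from `B`: they lie in different closed half-spaces. -/
def Separates {n : ℕ} (α : EuclideanSpace ℝ (Fin n)) (k : ℤ) (A B : Set (V n)) : Prop :=
  (A ⊆ upperHalf α k ∧ B ⊆ lowerHalf α k) ∨ (A ⊆ lowerHalf α k ∧ B ⊆ upperHalf α k)

/-- The `m`-Shi arrangement: the `H_{α,k}` with `α` a positive root and `-m < k ≤ m`. -/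
def shiArrangement (n m : ℕ) : Set (Set (V n)) :=
  {H | ∃ α ∈ posRoots n, ∃ k : ℤ, -(m : ℤ) < k ∧ k ≤ m ∧ H = hyperplane α k}

/-- The arrangement of all `H_{α,k}`, with `α` a positive root and `k` an integer. -/
def affineArrangement (n : ℕ) : Set (Set (V n)) :=
  {H | ∃ α ∈ posRoots n, ∃ k : ℤ, H = hyperplane α k}

/-- `R` is a connected component of the complement of the union of the hyperplanes in `𝓗`. -/
def IsRegionOf {n : ℕ} (𝓗 : Set (Set (V n))) (R : Set (V n)) : Prop :=
  ∃ x ∈ (⋃₀ 𝓗)ᶜ, R = connectedComponentIn (⋃₀ 𝓗)ᶜ x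

/-- An alcove: a region of the arrangement of all the `H_{α,k}`. -/
def IsAlcove {n : ℕ} (A : Set (V n)) : Prop := IsRegionOf (affineArrangement n) A

/-- The dominant chamber. -/
def dominantChamber (n : ℕ) : Set (V n) :=
  {v | ∀ i : ℕ, 1 ≤ i → i < n → v ∈ upperHalf (root n i i) 0}

/-- A dominant region of the `m`-Shi arrangement. -/
def IsDominantRegion {n : ℕ} (m : ℕ) (R : Set (V n)) : Prop :=
  IsRegionOf (shiArrangement n m) R ∧ R ⊆ dominantChamber n

/-- The fundamental alcove `A_0`. -/
def fundamentalAlcove (n : ℕ) : Set (V n) :=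
  interior (lowerHalf (theta n) 1 ∩ dominantChamber n)

/-- The set of hyperplanes `H_{α,k}` (as pairs of a positive root and an integer) which separate
`A` from the fundamental alcove. -/
def separatingSet {n : ℕ} (A : Set (V n)) : Set (EuclideanSpace ℝ (Fin n) × ℤ) :=
  {a | a.1 ∈ posRoots n ∧ Separates a.1 a.2 A (fundamentalAlcove n)}

/-- `A` is the `m`-minimal alcove of the region `R`, i.e. the alcove in `R` closest to the
fundamental alcove, distance being the number of separating hyperplanes. -/
def IsMinimalAlcove {n : ℕ} (R A : Set (V n)) : Prop :=
  IsAlcove A ∧ A ⊆ R ∧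
    ∀ B : Set (V n), IsAlcove B → B ⊆ R → (separatingSet A).encard ≤ (separatingSet B).encard

/-- `H_{α,k}` is a wall of the region `R` of the `m`-Shi arrangement: it belongs to the
arrangement and supports a facet of `R`, i.e. `closure R ∩ H_{α,k}` spans `H_{α,k}` affinely. -/
def IsWall {n : ℕ} (m : ℕ) (α : EuclideanSpace ℝ (Fin n)) (k : ℤ) (R : Set (V n)) : Prop :=
  hyperplane α k ∈ shiArrangement n m ∧
    (affineSpan ℝ (closure R ∩ hyperplane α k) : Set (V n)) = hyperplane α k

/-- `H_{α,k}` is a separating wall of `R`: a wall separating `R` from the fundamental alcove. -/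
def IsSeparatingWall {n : ℕ} (m : ℕ) (α : EuclideanSpace ℝ (Fin n)) (k : ℤ)
    (R : Set (V n)) : Prop :=
  IsWall m α k R ∧ Separates α k R (fundamentalAlcove n)

/-- `r(R)`: the number of pairs `(j, k)` with `1 ≤ j ≤ n - 1` and `1 ≤ k ≤ m` such that
`H_{α_{1j},k}` separates `R` from the fundamental alcove. -/
def rStat {n : ℕ} (m : ℕ) (R : Set (V n)) : ℕ :=
  Set.ncard {a : ℕ × ℕ | 1 ≤ a.1 ∧ a.1 < n ∧ 1 ≤ a.2 ∧ a.2 ≤ m ∧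
    Separates (root n 1 a.1) a.2 R (fundamentalAlcove n)}

/-- `c(R)`: the number of pairs `(i, k)` with `1 ≤ i ≤ n - 1` and `1 ≤ k ≤ m` such that
`H_{α_{i,n-1},k}` separates `R` from the fundamental alcove. -/
def cStat {n : ℕ} (m : ℕ) (R : Set (V n)) : ℕ :=
  Set.ncard {a : ℕ × ℕ | 1 ≤ a.1 ∧ a.1 < n ∧ 1 ≤ a.2 ∧ a.2 ≤ m ∧
    Separates (root n a.1 (n - 1)) a.2 R (fundamentalAlcove n)}

/-! ### The map `Ψ` -/

/-- `Ψ(lam)`: the alcove with Shi coordinates `k_{ij} = coreCoord n lam i j`, that is, the set of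
all `x` with `k_{ij} < ⟨x, α_{ij}⟩ < k_{ij} + 1` for `1 ≤ i ≤ j ≤ n - 1`. -/
def Psi (n : ℕ) (lam : YoungDiagram) : Set (V n) :=
  {x | ∀ i j : ℕ, 1 ≤ i → i ≤ j → j < n →
    (coreCoord n lam i j : ℝ) < inner ℝ (x : EuclideanSpace ℝ (Fin n)) (root n i j) ∧
    inner ℝ (x : EuclideanSpace ℝ (Fin n)) (root n i j) < (coreCoord n lam i j : ℝ) + 1}

end Shi

end

noncomputable section

namespace Shi

open Finset

/-! Both statistics are sums of Shi coordinates of the alcove of the core. As this alcove lies in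
`R`, for `1 ≤ k ≤ m` the hyperplane `H_{α,k}` separates `R` from the fundamental alcove iff `k` is
at most the coordinate of `α` (`separates_iff_le_coreCoord`). All coordinates lie in `[0, m]`, so
`r` is the sum of the `k_{1j}` and `c` the sum of the `k_{i,n-1}`.

The wall enters through a point of its facet where `α_{1j}` is not an integer. There the values of
`α_{1j}` and `α_{j+1,n-1}` add up to `m`, so their floors add up to `m - 1`. The bounds given by
these floors are Shi hyperplanes, hence hold on all of `R` (`IsDominantRegion.exists_floor`), and
`k_{1j} + k_{j+1,n-1} = m - 1`. This also gives `k_θ = m` when `n ≥ 3`; for `n = 2` there is no such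
`j`, and minimality of the alcove is used instead.

On the abacus `b_0 = 0`, so `p_1 = 0` and the `k_{1j}` are the level numbers of the other runners in
sorted order; they sum to the number of nonnegative beads, which is the length. The relation above
forces `p_n = mn + 1` and `b_1 = m` (`IsCore.sortedGap_last`). Then the `k_{i,n-1}` are explicit in
the `b_t`, and the largest bead `λ_1 + ℓ - 1` equals `p_n - n`, which gives `λ_1`. -/

/-! ### Hooks and beads -/

theorem hookLength_add {lam : YoungDiagram} {k l : ℕ} (h : (k, l) ∈ lam) :
    hookLength lam k l + k + l + 1 = lam.rowLen k + lam.colLen l := by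
  have hk := YoungDiagram.mem_iff_lt_colLen.1 h
  have hl := YoungDiagram.mem_iff_lt_rowLen.1 h
  have e : hook lam k l = ({k} ×ˢ Ico l (lam.rowLen k)) ∪ (Ico k (lam.colLen l) ×ˢ {l}) := by
    ext ⟨a, b⟩
    simp only [hook, mem_filter, YoungDiagram.mem_cells, mem_union, mem_product, mem_singleton,
      mem_Ico]
    constructor
    · rintro ⟨hm, ⟨rfl, hb⟩ | ⟨rfl, ha⟩⟩
      · exact Or.inl ⟨rfl, hb, YoungDiagram.mem_iff_lt_rowLen.1 hm⟩
      · exact Or.inr ⟨⟨ha, YoungDiagram.mem_iff_lt_colLen.1 hm⟩, rfl⟩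
    · rintro (⟨rfl, hb, hb'⟩ | ⟨⟨ha, ha'⟩, rfl⟩)
      · exact ⟨YoungDiagram.mem_iff_lt_rowLen.2 hb', Or.inl ⟨rfl, hb⟩⟩
      · exact ⟨YoungDiagram.mem_iff_lt_colLen.2 ha', Or.inr ⟨rfl, ha⟩⟩
  have e' : ({k} ×ˢ Ico l (lam.rowLen k)) ∩ (Ico k (lam.colLen l) ×ˢ {l}) = {(k, l)} := by
    ext ⟨a, b⟩
    simp only [mem_inter, mem_product, mem_singleton, mem_Ico, Prod.mk.injEq]
    omega
  have := card_union_add_card_inter ({k} ×ˢ Ico l (lam.rowLen k)) (Ico k (lam.colLen l) ×ˢ {l})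
  rw [← e, e'] at this
  simp only [card_singleton, card_product, Nat.card_Ico, one_mul, mul_one] at this
  unfold hookLength
  omega

theorem length_eq_colLen (lam : YoungDiagram) : length lam = lam.colLen 0 := by
  simp [length]

/-- The beads at nonnegative entries are the first column hook lengths `λ_k + ℓ - 1 - k`. -/
theorem mem_beads_iff {lam : YoungDiagram} {z : ℤ} :
    z ∈ beads lam ↔ z < 0 ∨ ∃ k < lam.colLen 0, z = lam.rowLen k + lam.colLen 0 - 1 - k := by
  have key : ∀ k, (k, 0) ∈ lam →
      (hookLength lam k 0 : ℤ) = lam.rowLen k + lam.colLen 0 - 1 - k := by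
    intro k hk
    have := hookLength_add hk
    omega
  simp only [beads, Set.mem_ofPred_eq]
  refine or_congr Iff.rfl (exists_congr fun k => ?_)
  rw [← YoungDiagram.mem_iff_lt_colLen]
  refine and_congr_right fun hk => ?_
  rw [key k hk]

theorem zero_notMem_beads (lam : YoungDiagram) : (0 : ℤ) ∉ beads lam := by
  rw [mem_beads_iff]
  rintro (h | ⟨k, hk, h⟩)
  · omega
  · have := YoungDiagram.mem_iff_lt_rowLen.1 (YoungDiagram.mem_iff_lt_colLen.2 hk)
    omega

theorem le_of_mem_beads {lam : YoungDiagram} {z : ℤ} (hz : z ∈ beads lam) :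
    z ≤ lam.rowLen 0 + lam.colLen 0 - 1 := by
  rcases mem_beads_iff.1 hz with h | ⟨k, hk, h⟩
  · by_cases h0 : lam.rowLen 0 + lam.colLen 0 = 0 <;> omega
  · have := lam.rowLen_anti _ _ (Nat.zero_le k)
    omega

/-- The beads of an `n`-core are flush. -/
theorem IsCore.sub_mem_beads {n : ℕ} {lam : YoungDiagram} (hlam : IsCore n lam) {z : ℤ}
    (hz : z ∈ beads lam) : z - n ∈ beads lam := by
  rcases mem_beads_iff.1 hz with h | ⟨k, hk, h⟩
  · exact mem_beads_iff.2 (Or.inl (by omega))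
  by_contra hg
  set g := z - n with hgdef
  have hg0 : 0 ≤ g := by
    by_contra hneg
    exact hg (mem_beads_iff.2 (Or.inl (by omega)))
  have hgap : ∀ i < lam.colLen 0, g ≠ lam.rowLen i + lam.colLen 0 - 1 - i :=
    fun i hi e => hg (mem_beads_iff.2 (Or.inr ⟨i, hi, e⟩))
  -- Let `t` be the first row whose bead is below the gap `g` (or the first row past the diagram).
  -- The column `l = g - ℓ + t` then has length exactly `t`, and the hook at `(k, l)` has length `z
  -- - g = n`, which a core forbids.
  have hex : ∃ t : ℕ, lam.colLen 0 ≤ t ∨ (lam.rowLen t + lam.colLen 0 - 1 - t : ℤ) < g :=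
    ⟨_, Or.inl le_rfl⟩
  classical
  obtain ⟨t, ht, hmin⟩ : ∃ t : ℕ,
      (lam.colLen 0 ≤ t ∨ (lam.rowLen t + lam.colLen 0 - 1 - t : ℤ) < g) ∧
      ∀ s < t, ¬ (lam.colLen 0 ≤ s ∨ (lam.rowLen s + lam.colLen 0 - 1 - s : ℤ) < g) :=
    ⟨Nat.find hex, Nat.find_spec hex, fun s hs => Nat.find_min hex hs⟩
  have hkt : k < t := by
    by_contra hle
    have := lam.rowLen_anti _ _ (Nat.le_of_not_lt hle)
    omega
  have hm := hmin (t - 1) (by omega)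
  have hgt := hgap (t - 1) (by omega)
  have ht' : (lam.rowLen t + lam.colLen 0 - t : ℤ) ≤ g := by
    rcases ht with ht | ht
    · have : t = lam.colLen 0 := by omega
      have h0 : lam.rowLen t = 0 := by
        by_contra hne
        have := YoungDiagram.mem_iff_lt_colLen.1
          (YoungDiagram.mem_iff_lt_rowLen.2 (Nat.pos_of_ne_zero hne))
        omega
      omega
    · omega
  obtain ⟨l, hl⟩ : ∃ l : ℕ, (l : ℤ) = g - lam.colLen 0 + t :=
    ⟨(g - lam.colLen 0 + t).toNat, by omega⟩
  have h1 : (t - 1, l) ∈ lam := YoungDiagram.mem_iff_lt_rowLen.2 (by omega)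
  have h2 : (t, l) ∉ lam := fun h => by
    have := YoungDiagram.mem_iff_lt_rowLen.1 h
    omega
  have hc : lam.colLen l = t := by
    have := YoungDiagram.mem_iff_lt_colLen.1 h1
    rw [YoungDiagram.mem_iff_lt_colLen] at h2
    omega
  have h3 : (k, l) ∈ lam := lam.up_left_mem (by omega) le_rfl h1
  have := hookLength_add h3
  exact hlam k l h3 ⟨1, by omega⟩

theorem IsCore.mem_beads_of_le {n : ℕ} {lam : YoungDiagram} (hlam : IsCore n lam) {q q' i : ℤ}
    (h : q' ≤ q) (hq : q * n + i ∈ beads lam) : q' * n + i ∈ beads lam := by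
  induction q', h using Int.leInductionDown with
  | base => exact hq
  | pred r _ ih =>
    have := hlam.sub_mem_beads ih
    convert this using 1
    ring

/-! ### Level numbers -/

/-- Level `-1` always carries a bead and the beads are bounded above, so the supremum is attained;
flushness then fills every level below it. -/
theorem IsCore.lt_levelNumber_iff {n : ℕ} {lam : YoungDiagram} (hlam : IsCore n lam) {i : ℕ}
    (hi : i < n) {q : ℤ} : q < levelNumber n lam i ↔ q * n + i ∈ beads lam := by
  have hne : {q : ℤ | q * n + i ∈ beads lam}.Nonempty :=
    ⟨-1, mem_beads_iff.2 (Or.inl (by omega))⟩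
  have hbdd : BddAbove {q : ℤ | q * n + i ∈ beads lam} := by
    refine ⟨lam.rowLen 0 + lam.colLen 0, fun q hq => ?_⟩
    have h := le_of_mem_beads hq
    by_contra hlt
    have : (1 : ℤ) ≤ n := by omega
    nlinarith
  have hmem := Int.csSup_mem hne hbdd
  unfold levelNumber
  rw [Int.lt_add_one_iff]
  exact ⟨fun h => hlam.mem_beads_of_le h hmem, fun h => le_csSup hbdd h⟩

theorem IsCore.levelNumber_nonneg {n : ℕ} {lam : YoungDiagram} (hlam : IsCore n lam) {i : ℕ}
    (hi : i < n) : 0 ≤ levelNumber n lam i := by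
  have : -1 < levelNumber n lam i :=
    (hlam.lt_levelNumber_iff hi).2 (mem_beads_iff.2 (Or.inl (by omega)))
  omega

theorem IsCore.levelNumber_zero {n : ℕ} {lam : YoungDiagram} (hlam : IsCore n lam)
    (hn : 0 < n) : levelNumber n lam 0 = 0 := by
  have h1 := hlam.levelNumber_nonneg hn
  have h2 : ¬ (0 : ℤ) < levelNumber n lam 0 := by
    rw [hlam.lt_levelNumber_iff hn]
    simpa using zero_notMem_beads lam
  omega

/-- The nonnegative beads are counted twice: by rows of the diagram, and by runners, where runner
`i` carries those on levels `0, …, b_i - 1`. -/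
theorem IsCore.sum_levelNumber {n : ℕ} {lam : YoungDiagram} (hlam : IsCore n lam) (hn : 0 < n) :
    ∑ i ∈ range n, levelNumber n lam i = length lam := by
  have e : (range (lam.colLen 0)).image
      (fun k : ℕ => (lam.rowLen k + lam.colLen 0 - 1 - k : ℤ)) =
      ((range n).sigma fun i => range (levelNumber n lam i).toNat).image
        (fun a => ((a.2 * n + a.1 : ℕ) : ℤ)) := by
    ext z
    simp only [mem_image, mem_range, mem_sigma]
    constructor
    · rintro ⟨k, hk, rfl⟩
      have hz := mem_beads_iff.2 (Or.inr ⟨k, hk, rfl⟩ : _ ∨ _)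
      have := YoungDiagram.mem_iff_lt_rowLen.1 (YoungDiagram.mem_iff_lt_colLen.2 hk)
      obtain ⟨w, hw⟩ : ∃ w : ℕ, (w : ℤ) = lam.rowLen k + lam.colLen 0 - 1 - k :=
        ⟨(lam.rowLen k + lam.colLen 0 - 1 - k : ℤ).toNat, by omega⟩
      have hd : w / n * n + w % n = w := Nat.div_add_mod' w n
      refine ⟨⟨w % n, w / n⟩, ⟨Nat.mod_lt _ hn, ?_⟩, by rw [← hw]; exact_mod_cast hd⟩
      rw [← hw] at hz
      have : ((w / n : ℕ) : ℤ) < levelNumber n lam (w % n) := by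
        rw [hlam.lt_levelNumber_iff (Nat.mod_lt _ hn)]
        convert hz using 1
        exact_mod_cast hd
      exact Int.lt_toNat.2 this
    · rintro ⟨⟨i, q⟩, ⟨hi, hq⟩, rfl⟩
      have : (q : ℤ) < levelNumber n lam i := Int.lt_toNat.1 hq
      rw [hlam.lt_levelNumber_iff hi] at this
      rcases mem_beads_iff.1 this with h | ⟨k, hk, h⟩
      · have : (0 : ℤ) ≤ q * n := by positivity
        omega
      · exact ⟨k, hk, by rw [← h]; push_cast; rfl⟩
  have c1 : ((range (lam.colLen 0)).image
      (fun k : ℕ => (lam.rowLen k + lam.colLen 0 - 1 - k : ℤ))).card = lam.colLen 0 := by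
    rw [card_image_of_injective, card_range]
    intro a b hab
    rcases le_total a b with h | h
    · have := lam.rowLen_anti _ _ h
      simp only at hab
      omega
    · have := lam.rowLen_anti _ _ h
      simp only at hab
      omega
  have c2 : (((range n).sigma fun i => range (levelNumber n lam i).toNat).image
        (fun a => ((a.2 * n + a.1 : ℕ) : ℤ))).card =
      ∑ i ∈ range n, (levelNumber n lam i).toNat := by
    rw [card_image_of_injOn, card_sigma]
    · simp
    · rintro ⟨i, q⟩ h ⟨i', q'⟩ h' hab
      simp only [coe_sigma, Set.mem_sigma_iff, mem_coe, mem_range] at h h'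
      have hab' : q * n + i = q' * n + i' := Int.ofNat_inj.1 hab
      have hi : i = i' := by
        have := congrArg (· % n) hab'
        simpa [Nat.mod_eq_of_lt h.1, Nat.mod_eq_of_lt h'.1] using this
      subst hi
      have hq : q = q' := Nat.eq_of_mul_eq_mul_right hn (Nat.add_right_cancel hab')
      rw [hq]
  rw [length_eq_colLen, ← c1, e, c2, Nat.cast_sum]
  refine sum_congr rfl fun i hi => ?_
  rw [Int.toNat_of_nonneg (hlam.levelNumber_nonneg (mem_range.1 hi))]

/-! ### Sorted first gaps and the coordinates they define -/

theorem sortedGap_succ {n : ℕ} {lam : YoungDiagram} (s : Fin n) :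
    sortedGap n lam (s + 1) = gapEntry n lam (Tuple.sort (gapEntry n lam) s) := by
  simp [sortedGap]

theorem coreCoord_eq {n : ℕ} {lam : YoungDiagram} (i j : ℕ) :
    coreCoord n lam i j = (sortedGap n lam (j + 1) - sortedGap n lam i) / (n : ℤ) := by
  unfold coreCoord
  rw [← Rat.floor_intCast_div_natCast, ← Rat.floor_cast (α := ℝ)]
  push_cast
  rfl

/-- Runner `0` has its first gap at `0`, and all first gaps are nonnegative; an entry `b_i n + i ≤
0` forces `i = 0`. -/
theorem IsCore.sort_gapEntry_zero {n : ℕ} {lam : YoungDiagram} (hlam : IsCore n lam)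
    (hn : 0 < n) : Tuple.sort (gapEntry n lam) ⟨0, hn⟩ = ⟨0, hn⟩ := by
  set σ := Tuple.sort (gapEntry n lam) with hσ
  have h1 : gapEntry n lam (σ ⟨0, hn⟩) ≤ gapEntry n lam (σ (σ.symm ⟨0, hn⟩)) :=
    Tuple.monotone_sort (gapEntry n lam) (Fin.mk_le_of_le_val (Nat.zero_le _))
  rw [Equiv.apply_symm_apply] at h1
  have h2 : gapEntry n lam ⟨0, hn⟩ = 0 := by simp [gapEntry, hlam.levelNumber_zero hn]
  have h3 := mul_nonneg (hlam.levelNumber_nonneg (σ ⟨0, hn⟩).2) (Int.natCast_nonneg n)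
  rw [h2] at h1
  unfold gapEntry at h1
  exact Fin.ext (by change _ = 0; omega)

theorem IsCore.sortedGap_one {n : ℕ} {lam : YoungDiagram} (hlam : IsCore n lam)
    (hn : 0 < n) : sortedGap n lam 1 = 0 := by
  have := sortedGap_succ (lam := lam) (⟨0, hn⟩ : Fin n)
  rw [hlam.sort_gapEntry_zero hn] at this
  simpa [gapEntry, hlam.levelNumber_zero hn] using this

theorem gapEntry_ediv {n : ℕ} {lam : YoungDiagram} (t : Fin n) :
    gapEntry n lam t / (n : ℤ) = levelNumber n lam t := by
  have ht := t.2
  unfold gapEntry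
  rw [Int.add_comm, Int.add_mul_ediv_right _ _ (by omega), Int.ediv_eq_zero_of_lt (by omega)
    (by omega), zero_add]

theorem IsCore.coreCoord_one {n : ℕ} {lam : YoungDiagram} (hlam : IsCore n lam) (s : Fin n) :
    coreCoord n lam 1 s = levelNumber n lam (Tuple.sort (gapEntry n lam) s) := by
  rw [coreCoord_eq, hlam.sortedGap_one s.pos, sub_zero, sortedGap_succ, gapEntry_ediv]

theorem IsCore.sum_coreCoord_one {n : ℕ} {lam : YoungDiagram} (hlam : IsCore n lam)
    (hn : 0 < n) : ∑ j ∈ Ico 1 n, coreCoord n lam 1 j = ∑ i ∈ range n, levelNumber n lam i := by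
  -- The index `0` is outside the range of roots; its value `0` completes the sum to all runners, so
  -- that the sorting permutation can be removed.
  have h0 : coreCoord n lam 1 0 = 0 := by simp [coreCoord_eq]
  have : ∑ j ∈ range n, coreCoord n lam 1 j = ∑ j ∈ Ico 1 n, coreCoord n lam 1 j := by
    rw [range_eq_Ico, sum_eq_sum_Ico_succ_bot hn, h0, zero_add]
  rw [← this, sum_range, sum_range]
  simp_rw [hlam.coreCoord_one]
  exact Equiv.sum_comp (Tuple.sort (gapEntry n lam)) fun t => levelNumber n lam t

theorem gapEntry_le_sortedGap_last {n : ℕ} {lam : YoungDiagram} (t : Fin n) :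
    gapEntry n lam t ≤ sortedGap n lam n := by
  have ht := t.2
  have e := sortedGap_succ (lam := lam) (⟨n - 1, by omega⟩ : Fin n)
  simp only [show n - 1 + 1 = n by omega] at e
  rw [e]
  have := Tuple.monotone_sort (gapEntry n lam)
    (show (Tuple.sort (gapEntry n lam)).symm t ≤ ⟨n - 1, by omega⟩ from
      Fin.le_def.2 (by change _ ≤ n - 1; omega))
  simpa using this

/-- If `H_{θ,m}` bounds the alcove of an `n`-core from below, the largest first gap is `mn+1`. -/
theorem IsCore.sortedGap_last {n m : ℕ} {lam : YoungDiagram} (hlam : IsCore n lam)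
    (hn : 2 ≤ n) (hθ : coreCoord n lam 1 (n - 1) = m)
    (hsum : ∀ j, 1 ≤ j → j + 1 < n →
      coreCoord n lam 1 j + coreCoord n lam (j + 1) (n - 1) = m - 1) :
    sortedGap n lam n = m * n + 1 ∧ levelNumber n lam 1 = m := by
  set σ := Tuple.sort (gapEntry n lam) with hσ
  have e := sortedGap_succ (lam := lam) (⟨n - 1, by omega⟩ : Fin n)
  simp only [show n - 1 + 1 = n by omega] at e
  have hl := hlam.coreCoord_one (⟨n - 1, by omega⟩ : Fin n)
  simp only [hθ] at hl
  rw [← hσ] at e hl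
  set r := σ ⟨n - 1, by omega⟩ with hr
  have hp : sortedGap n lam n = m * n + r := by rw [e, gapEntry, ← hl]
  have hr0 : r ≠ ⟨0, by omega⟩ := by
    intro h
    rw [← hlam.sort_gapEntry_zero (by omega), hr] at h
    have := congrArg Fin.val (σ.injective h)
    simp only at this
    omega
  have hr0' : (r : ℕ) ≠ 0 := fun h => hr0 (Fin.ext h)
  -- Otherwise runner `1` sits at an intermediate position `s`. Then `k_{1s} = b_1`, and
  -- `k_{s+1,n-1} = m - b_1` because `0 ≤ r - 1 < n`; the sum is `m` rather than `m - 1`.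
  have hr1 : (r : ℕ) = 1 := by
    by_contra hne
    set s := σ.symm ⟨1, by omega⟩ with hs
    have hσs : σ s = ⟨1, by omega⟩ := by simp [hs]
    have hs0 : (s : ℕ) ≠ 0 := by
      intro h
      have h' : s = ⟨0, by omega⟩ := Fin.ext h
      rw [h', hlam.sort_gapEntry_zero (by omega)] at hσs
      exact absurd (congrArg Fin.val hσs) (by simp)
    have hsn : (s : ℕ) ≠ n - 1 := by
      intro h
      have h' : s = ⟨n - 1, by omega⟩ := Fin.ext h
      rw [h', ← hr] at hσs
      exact hne (congrArg Fin.val hσs)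
    have h := hsum s (by omega) (by have := s.2; omega)
    rw [hlam.coreCoord_one, coreCoord_eq, show n - 1 + 1 = n by omega, sortedGap_succ, ← hσ, hσs,
      hp, gapEntry] at h
    simp only at h
    rw [show (m * n + r - (levelNumber n lam 1 * n + (1 : ℕ)) : ℤ) =
      (r - 1) + (m - levelNumber n lam 1) * n by push_cast; ring,
      Int.add_mul_ediv_right _ _ (by omega), Int.ediv_eq_zero_of_lt (by omega) (by omega)] at h
    omega
  rw [hr1] at hp hl
  exact ⟨hp, hl.symm⟩

/-- The quotient is `m - b_t + ⌊(1 - t)/n⌋`, and the last floor is `0` for `t ≤ 1` and `-1` for `2 ≤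
t < n`. -/
theorem coreCoord_last {n m : ℕ} {lam : YoungDiagram} (hn : 2 ≤ n)
    (hp : sortedGap n lam n = m * n + 1) (s : Fin n) :
    coreCoord n lam (s + 1) (n - 1) = m - levelNumber n lam (Tuple.sort (gapEntry n lam) s) -
      if 2 ≤ (Tuple.sort (gapEntry n lam) s : ℕ) then 1 else 0 := by
  have hs := s.2
  rw [coreCoord_eq, show n - 1 + 1 = n by omega, sortedGap_succ, hp]
  set t := Tuple.sort (gapEntry n lam) s
  have ht := t.2
  rw [gapEntry, show (m * n + 1 - (levelNumber n lam t * n + (t : ℕ)) : ℤ) =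
      (1 - (t : ℕ)) + (m - levelNumber n lam t) * n by ring,
      Int.add_mul_ediv_right _ _ (by omega)]
  split_ifs with h
  · have : (1 - (t : ℕ) : ℤ) / n = -1 := by
      rw [Int.ediv_eq_iff_of_pos (by omega)]
      constructor <;> omega
    omega
  · rw [Int.ediv_eq_zero_of_lt (by omega) (by omega)]
    omega

/-! ### Pairing with roots -/

/-- The functional `v ↦ ⟨v, α⟩` on `V`. -/
def pairing {n : ℕ} (α : EuclideanSpace ℝ (Fin n)) : V n →L[ℝ] ℝ :=
  (innerSL ℝ α).comp (V n).subtypeL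

theorem pairing_apply {n : ℕ} (α : EuclideanSpace ℝ (Fin n)) (v : V n) :
    inner ℝ (v : EuclideanSpace ℝ (Fin n)) α = pairing α v :=
  real_inner_comm _ _

theorem pairing_root {n i j : ℕ} (hij : i < n) (hj : j < n) (v : V n) :
    pairing (root n (i + 1) j) v =
      (v : EuclideanSpace ℝ (Fin n)) ⟨i, hij⟩ - (v : EuclideanSpace ℝ (Fin n)) ⟨j, hj⟩ := by
  have h : ∀ k (hk : k < n), inner ℝ (v : EuclideanSpace ℝ (Fin n)) (eps n (k + 1)) =
      (v : EuclideanSpace ℝ (Fin n)) ⟨k, hk⟩ := by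
    intro k hk
    simp only [eps, PiLp.inner_apply, Nat.add_right_cancel_iff]
    rw [Finset.sum_eq_single ⟨k, hk⟩]
    · simp
    · intro b _ hb
      have : (b : ℕ) ≠ k := fun e => hb (Fin.ext e)
      simp [this]
    · simp
  rw [← pairing_apply, root, inner_sub_right, h, h]

theorem mem_hyperplane {n : ℕ} {α : EuclideanSpace ℝ (Fin n)} {k : ℤ} {v : V n} :
    v ∈ hyperplane α k ↔ pairing α v = k := by
  rw [← pairing_apply]; rfl

theorem mem_upperHalf {n : ℕ} {α : EuclideanSpace ℝ (Fin n)} {k : ℤ} {v : V n} :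
    v ∈ upperHalf α k ↔ (k : ℝ) ≤ pairing α v := by
  rw [← pairing_apply]; rfl

theorem mem_lowerHalf {n : ℕ} {α : EuclideanSpace ℝ (Fin n)} {k : ℤ} {v : V n} :
    v ∈ lowerHalf α k ↔ pairing α v ≤ k := by
  rw [← pairing_apply]; rfl

theorem pairing_root_add {n i j k : ℕ} (v : V n) :
    pairing (root n i j) v + pairing (root n (j + 1) k) v = pairing (root n i k) v := by
  simp only [← pairing_apply, root, ← inner_add_right, sub_add_sub_cancel]

theorem root_mem_posRoots {n i j : ℕ} (h1 : 1 ≤ i) (h2 : i ≤ j) (h3 : j < n) :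
    root n i j ∈ posRoots n := ⟨i, j, h1, h2, h3, rfl⟩

theorem pairing_root_nonneg {n : ℕ} {v : V n} (hv : v ∈ dominantChamber n) {i j : ℕ}
    (h1 : 1 ≤ i) (h2 : i ≤ j) (h3 : j < n) : 0 ≤ pairing (root n i j) v := by
  induction j, h2 using Nat.le_induction with
  | base => simpa using mem_upperHalf.1 (hv i h1 h3)
  | succ j hij ih =>
    rw [← pairing_root_add (j := j)]
    have := mem_upperHalf.1 (hv (j + 1) (by omega) h3)
    exact add_nonneg (ih (by omega)) (by simpa using this)

/-- On the dominant chamber every positive root is at most `θ`. -/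
theorem pairing_root_le_theta {n : ℕ} {v : V n} (hv : v ∈ dominantChamber n) {i j : ℕ}
    (h1 : 1 ≤ i) (h2 : i ≤ j) (h3 : j < n) : pairing (root n i j) v ≤ pairing (theta n) v := by
  have a : pairing (root n i j) v ≤ pairing (root n 1 j) v := by
    obtain ⟨i, rfl⟩ : ∃ i', i = i' + 1 := ⟨i - 1, by omega⟩
    rcases Nat.eq_zero_or_pos i with rfl | hi
    · exact le_rfl
    · rw [← pairing_root_add (i := 1) (j := i)]
      have := pairing_root_nonneg hv le_rfl hi (by omega)
      linarith
  have b : pairing (root n 1 j) v ≤ pairing (theta n) v := by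
    rcases Nat.eq_or_lt_of_le (Nat.le_sub_one_of_lt h3) with h | h
    · rw [theta, ← h]
    · rw [theta, ← pairing_root_add (i := 1) (j := j) (k := n - 1)]
      have := pairing_root_nonneg hv (Nat.le_add_left 1 j) (show j + 1 ≤ n - 1 by omega) (by omega)
      linarith
  exact a.trans b

/-- A vector on which every simple root takes the value `1`. -/
def weylVector (n : ℕ) : V n :=
  ⟨WithLp.toLp 2 fun t : Fin n => (∑ s : Fin n, (s : ℝ)) / n - t, by
    change ∑ t : Fin n, ((∑ s : Fin n, (s : ℝ)) / n - t) = 0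
    rcases Nat.eq_zero_or_pos n with rfl | hn
    · simp
    · rw [Finset.sum_sub_distrib, Finset.sum_const, card_univ, Fintype.card_fin, nsmul_eq_mul,
        mul_div_cancel₀ _ (by positivity), sub_self]⟩

theorem pairing_weylVector {n i j : ℕ} (h1 : 1 ≤ i) (h2 : i ≤ j) (h3 : j < n) :
    pairing (root n i j) (weylVector n) = j + 1 - i := by
  obtain ⟨i, rfl⟩ : ∃ i', i = i' + 1 := ⟨i - 1, by omega⟩
  rw [pairing_root (by omega) h3]
  simp only [weylVector]
  push_cast
  ring

/-! ### The fundamental alcove -/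

theorem pairing_root_le_one {n : ℕ} {v : V n} (hv : v ∈ fundamentalAlcove n) {i j : ℕ}
    (h1 : 1 ≤ i) (h2 : i ≤ j) (h3 : j < n) : pairing (root n i j) v ≤ 1 := by
  have h := interior_subset hv
  have := mem_lowerHalf.1 h.1
  exact (pairing_root_le_theta h.2 h1 h2 h3).trans (by simpa using this)

theorem exists_mem_fundamentalAlcove (n : ℕ) : ∃ v ∈ fundamentalAlcove n,
    ∀ i j, 1 ≤ i → i ≤ j → j < n → 0 < pairing (root n i j) v ∧ pairing (root n i j) v < 1 := by
  -- On the Weyl vector divided by `n`, a root takes the value (height)/`n`, strictly between `0`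
  -- and `1`.
  have hval : ∀ i j, 1 ≤ i → i ≤ j → j < n →
      0 < pairing (root n i j) ((1 / n : ℝ) • weylVector n) ∧
      pairing (root n i j) ((1 / n : ℝ) • weylVector n) < 1 := by
    intro i j h1 h2 h3
    rw [map_smul, pairing_weylVector h1 h2 h3, smul_eq_mul, one_div, inv_mul_eq_div]
    have hn : (0 : ℝ) < n := by exact_mod_cast (by omega : 0 < n)
    have h1' : (1 : ℝ) ≤ i := by exact_mod_cast h1
    have h2' : (i : ℝ) ≤ j := by exact_mod_cast h2
    have h3' : (j : ℝ) < n := by exact_mod_cast h3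
    exact ⟨div_pos (by linarith) hn, (div_lt_one hn).2 (by linarith)⟩
  refine ⟨(1 / n : ℝ) • weylVector n, ?_, hval⟩
  rw [fundamentalAlcove, mem_interior]
  refine ⟨{v | pairing (theta n) v < 1} ∩
    ⋂ i ∈ Ico 1 n, {v | 0 < pairing (root n i i) v}, ?_, ?_, ?_⟩
  · rintro v ⟨h1, h2⟩
    refine ⟨mem_lowerHalf.2 (by simpa using le_of_lt h1), fun i hi hin => mem_upperHalf.2 ?_⟩
    have := Set.mem_iInter₂.1 h2 i (mem_Ico.2 ⟨hi, hin⟩)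
    simpa using le_of_lt this
  · refine (isOpen_lt (by fun_prop) (by fun_prop)).inter (isOpen_biInter_finset fun i _ => ?_)
    exact isOpen_lt (by fun_prop) (by fun_prop)
  · constructor
    -- For `n < 2` truncated subtraction makes `theta n` the zero vector.
    · rcases Nat.lt_or_ge n 2 with h | h
      · have : root n 1 (n - 1) = 0 := by
          have : n = 0 ∨ n = 1 := by omega
          rcases this with rfl | rfl
          · exact Subsingleton.elim _ _
          · simp [root]
        change pairing (root n 1 (n - 1)) _ < 1
        rw [this, ← pairing_apply]
        simp
      · exact (hval 1 (n - 1) le_rfl (by omega) (by omega)).2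
    · exact Set.mem_iInter₂.2 fun i hi =>
        (hval i i (mem_Ico.1 hi).1 le_rfl (mem_Ico.1 hi).2).1

/-- For `k ≥ 1`, `H_{α,k}` separates `A` from the fundamental alcove iff `A` lies above it. -/
theorem separates_iff {n : ℕ} {i j : ℕ} (h1 : 1 ≤ i) (h2 : i ≤ j) (h3 : j < n) {k : ℤ}
    (hk : 1 ≤ k) (A : Set (V n)) :
    Separates (root n i j) k A (fundamentalAlcove n) ↔ A ⊆ upperHalf (root n i j) k := by
  have hk' : (1 : ℝ) ≤ k := by exact_mod_cast hk
  constructor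
  · rintro (h | h)
    · exact h.1
    · obtain ⟨v, hv, hval⟩ := exists_mem_fundamentalAlcove n
      have := mem_upperHalf.1 (h.2 hv)
      linarith [hval i j h1 h2 h3]
  · exact fun h => Or.inl ⟨h, fun v hv =>
      mem_lowerHalf.2 ((pairing_root_le_one hv h1 h2 h3).trans hk')⟩

/-! ### Regions are sign cells -/

/-- The points lying strictly on the same side as `x` of every hyperplane of `𝓗`. -/
def cell {n : ℕ} (𝓗 : Set (Set (V n))) (x : V n) : Set (V n) :=
  {z | ∀ (α : EuclideanSpace ℝ (Fin n)) (k : ℤ), hyperplane α k ∈ 𝓗 →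
    ((k : ℝ) < pairing α x → (k : ℝ) < pairing α z) ∧
    (pairing α x < (k : ℝ) → pairing α z < (k : ℝ))}

theorem convex_cell {n : ℕ} (𝓗 : Set (Set (V n))) (x : V n) : Convex ℝ (cell 𝓗 x) := by
  intro y hy z hz a b ha hb hab α k hk
  have e : pairing α (a • y + b • z) = a * pairing α y + b * pairing α z := by simp
  obtain ⟨y1, y2⟩ := hy α k hk
  obtain ⟨z1, z2⟩ := hz α k hk
  rw [e]
  have hI := convex_Ioi (𝕜 := ℝ) (k : ℝ)
  have hI' := convex_Iio (𝕜 := ℝ) (k : ℝ)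
  exact ⟨fun h => hI (y1 h) (z1 h) ha hb hab, fun h => hI' (y2 h) (z2 h) ha hb hab⟩

/-- A functional maps the component to an interval that misses `k`, so no side changes; conversely
the cell is convex and avoids all the hyperplanes. -/
theorem connectedComponentIn_eq_cell {n : ℕ} {𝓗 : Set (Set (V n))}
    (h𝓗 : ∀ H ∈ 𝓗, ∃ α : EuclideanSpace ℝ (Fin n), ∃ k : ℤ, H = hyperplane α k)
    {x : V n} (hx : x ∈ (⋃₀ 𝓗)ᶜ) : connectedComponentIn (⋃₀ 𝓗)ᶜ x = cell 𝓗 x := by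
  have hne : ∀ z ∈ (⋃₀ 𝓗)ᶜ, ∀ α k, hyperplane α k ∈ 𝓗 → pairing α z ≠ k :=
    fun z hz α k hk e => hz ⟨_, hk, mem_hyperplane.2 e⟩
  apply Set.Subset.antisymm
  · intro z hz α k hk
    have hc : IsPreconnected (pairing α '' connectedComponentIn (⋃₀ 𝓗)ᶜ x) :=
      isPreconnected_connectedComponentIn.image _ (pairing α).continuous.continuousOn
    have hk' : (k : ℝ) ∉ pairing α '' connectedComponentIn (⋃₀ 𝓗)ᶜ x := by
      rintro ⟨w, hw, e⟩
      exact hne w (connectedComponentIn_subset _ _ hw) α k hk e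
    have hxz := hne z (connectedComponentIn_subset _ _ hz) α k hk
    have hmx : pairing α x ∈ pairing α '' connectedComponentIn (⋃₀ 𝓗)ᶜ x :=
      ⟨x, mem_connectedComponentIn hx, rfl⟩
    have hmz : pairing α z ∈ pairing α '' connectedComponentIn (⋃₀ 𝓗)ᶜ x := ⟨z, hz, rfl⟩
    constructor
    · intro h
      by_contra hle
      exact hk' (hc.ordConnected.out hmz hmx ⟨le_of_not_gt hle, h.le⟩)
    · intro h
      by_contra hle
      exact hk' (hc.ordConnected.out hmx hmz ⟨h.le, le_of_not_gt hle⟩)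
  · refine (convex_cell 𝓗 x).isPreconnected.subset_connectedComponentIn
      (fun α k _ => ⟨id, id⟩) ?_
    rintro z hz ⟨H, hH, hzH⟩
    obtain ⟨α, k, rfl⟩ := h𝓗 H hH
    have := mem_hyperplane.1 hzH
    rcases lt_or_gt_of_ne (hne x hx α k hH) with h | h
    · exact absurd this ((hz α k hH).2 h).ne
    · exact absurd this ((hz α k hH).1 h).ne'

theorem IsRegionOf.eq_cell {n : ℕ} {𝓗 : Set (Set (V n))}
    (h𝓗 : ∀ H ∈ 𝓗, ∃ α : EuclideanSpace ℝ (Fin n), ∃ k : ℤ, H = hyperplane α k)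
    {R : Set (V n)} (hR : IsRegionOf 𝓗 R) {a : V n} (ha : a ∈ R) :
    a ∈ (⋃₀ 𝓗)ᶜ ∧ R = cell 𝓗 a := by
  obtain ⟨x, hx, rfl⟩ := hR
  have h := connectedComponentIn_subset _ _ ha
  refine ⟨h, ?_⟩
  rw [connectedComponentIn_eq ha, connectedComponentIn_eq_cell h𝓗 h]

theorem IsRegionOf.nonempty {n : ℕ} {𝓗 : Set (Set (V n))} {R : Set (V n)}
    (hR : IsRegionOf 𝓗 R) : R.Nonempty := by
  obtain ⟨x, hx, rfl⟩ := hR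
  exact ⟨x, mem_connectedComponentIn hx⟩

theorem exists_hyperplane_of_mem_shiArrangement {n m : ℕ} :
    ∀ H ∈ shiArrangement n m, ∃ α : EuclideanSpace ℝ (Fin n), ∃ k : ℤ, H = hyperplane α k := by
  rintro H ⟨α, _, k, _, _, rfl⟩
  exact ⟨α, k, rfl⟩

theorem hyperplane_mem_shiArrangement {n m i j : ℕ} {k : ℤ} (h1 : 1 ≤ i) (h2 : i ≤ j)
    (h3 : j < n) (hk : -(m : ℤ) < k) (hk' : k ≤ m) :
    hyperplane (root n i j) k ∈ shiArrangement n m :=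
  ⟨_, root_mem_posRoots h1 h2 h3, k, hk, hk', rfl⟩

variable {n m : ℕ} {R : Set (V n)} {a : V n} {lam : YoungDiagram}

/-! ### Sides of Shi hyperplanes -/

theorem IsRegionOf.pairing_ne (hR : IsRegionOf (shiArrangement n m) R) (ha : a ∈ R) {i j : ℕ}
    {k : ℤ} (h1 : 1 ≤ i) (h2 : i ≤ j) (h3 : j < n) (hk : -(m : ℤ) < k) (hk' : k ≤ m) :
    pairing (root n i j) a ≠ k := fun e =>
  (hR.eq_cell exists_hyperplane_of_mem_shiArrangement ha).1
    ⟨_, hyperplane_mem_shiArrangement h1 h2 h3 hk hk', mem_hyperplane.2 e⟩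

theorem IsRegionOf.subset_upperHalf_iff (hR : IsRegionOf (shiArrangement n m) R) (ha : a ∈ R)
    {i j : ℕ} {k : ℤ} (h1 : 1 ≤ i) (h2 : i ≤ j) (h3 : j < n) (hk : -(m : ℤ) < k) (hk' : k ≤ m) :
    R ⊆ upperHalf (root n i j) k ↔ (k : ℝ) ≤ pairing (root n i j) a := by
  refine ⟨fun h => mem_upperHalf.1 (h ha), fun h z hz => mem_upperHalf.2 ?_⟩
  have hlt := lt_of_le_of_ne h (hR.pairing_ne ha h1 h2 h3 hk hk').symm
  rw [(hR.eq_cell exists_hyperplane_of_mem_shiArrangement ha).2] at hz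
  exact ((hz _ k (hyperplane_mem_shiArrangement h1 h2 h3 hk hk')).1 hlt).le

/-- A strict inequality at a closure point persists at a nearby point of `R`, hence on all of `R`,
which lies on one side of each Shi hyperplane. This carries bounds from the facet to the region. -/
theorem IsRegionOf.lt_pairing_of_closure (hR : IsRegionOf (shiArrangement n m) R) (ha : a ∈ R)
    {y : V n} (hy : y ∈ closure R) {i j : ℕ} {k : ℤ} (h1 : 1 ≤ i) (h2 : i ≤ j) (h3 : j < n)
    (hk : -(m : ℤ) < k) (hk' : k ≤ m) (h : (k : ℝ) < pairing (root n i j) y) :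
    (k : ℝ) < pairing (root n i j) a := by
  obtain ⟨z, hz, hzR⟩ := mem_closure_iff.1 hy {z | (k : ℝ) < pairing (root n i j) z}
    (isOpen_lt (by fun_prop) (by fun_prop)) h
  rw [(hR.eq_cell exists_hyperplane_of_mem_shiArrangement hzR).2] at ha
  exact (ha _ k (hyperplane_mem_shiArrangement h1 h2 h3 hk hk')).1 hz

theorem IsRegionOf.pairing_lt_of_closure (hR : IsRegionOf (shiArrangement n m) R) (ha : a ∈ R)
    {y : V n} (hy : y ∈ closure R) {i j : ℕ} {k : ℤ} (h1 : 1 ≤ i) (h2 : i ≤ j) (h3 : j < n)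
    (hk : -(m : ℤ) < k) (hk' : k ≤ m) (h : pairing (root n i j) y < k) :
    pairing (root n i j) a < k := by
  obtain ⟨z, hz, hzR⟩ := mem_closure_iff.1 hy {z | pairing (root n i j) z < k}
    (isOpen_lt (by fun_prop) (by fun_prop)) h
  rw [(hR.eq_cell exists_hyperplane_of_mem_shiArrangement hzR).2] at ha
  exact (ha _ k (hyperplane_mem_shiArrangement h1 h2 h3 hk hk')).2 hz

theorem IsDominantRegion.pairing_closure_nonneg (hR : IsDominantRegion m R) {y : V n}
    (hy : y ∈ closure R) {i j : ℕ} (h1 : 1 ≤ i) (h2 : i ≤ j) (h3 : j < n) :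
    0 ≤ pairing (root n i j) y := by
  have hc : IsClosed {z : V n | 0 ≤ pairing (root n i j) z} :=
    isClosed_le (by fun_prop) (by fun_prop)
  exact closure_minimal (fun z hz => pairing_root_nonneg (hR.2 hz) h1 h2 h3) hc hy

/-! ### The facet in `H_{θ,m}` -/

/-- The facet of a region in `H_{θ,m}` is not contained in the hyperplanes parallel to
`H_{α_{1j},0}` at integer distance. -/
theorem exists_closure_pairing_ne (hR : IsRegionOf (shiArrangement n m) R)
    (hw : IsWall m (theta n) m R) {j : ℕ} (h1 : 1 ≤ j) (h2 : j + 1 < n) :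
    ∃ y ∈ closure R, pairing (theta n) y = m ∧ ∀ k : ℤ, pairing (root n 1 j) y ≠ k := by
  -- If `α_{1j}` is integral on the facet, it is constant there by convexity, so the affine span of
  -- the facet lies in a level set of `α_{1j}`. But that span is `H_{θ,m}`, on which `α_{1j}`
  -- varies.
  by_contra! hcon
  have hn0 : (0 : ℝ) < n - 1 := by
    have : (2 : ℝ) < n := by exact_mod_cast (by omega : 2 < n)
    linarith
  have hspan := hw.2
  have hmem : ∀ y, y ∈ closure R ∩ hyperplane (theta n) m ↔
      y ∈ closure R ∧ pairing (theta n) y = m := by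
    intro y
    rw [Set.mem_inter_iff, mem_hyperplane, Int.cast_natCast]
  have hHne : (hyperplane (theta n) (m : ℤ)).Nonempty := by
    refine ⟨(m / (n - 1) : ℝ) • weylVector n, mem_hyperplane.2 ?_⟩
    rw [map_smul, theta, pairing_weylVector le_rfl (by omega) (by omega), smul_eq_mul,
      Nat.cast_sub (by omega), Nat.cast_one, Int.cast_natCast, sub_add_cancel,
      div_mul_cancel₀ _ hn0.ne']
  obtain ⟨y₀, hy₀⟩ : (closure R ∩ hyperplane (theta n) (m : ℤ)).Nonempty := by
    rw [← affineSpan_nonempty ℝ, hspan]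
    exact hHne
  obtain ⟨k₀, hk₀⟩ := hcon y₀ ((hmem _).1 hy₀).1 ((hmem _).1 hy₀).2
  have hconv : Convex ℝ R := by
    obtain ⟨x, hx⟩ := hR.nonempty
    rw [(hR.eq_cell exists_hyperplane_of_mem_shiArrangement hx).2]
    exact convex_cell _ _
  have hconst : ∀ y ∈ closure R ∩ hyperplane (theta n) (m : ℤ),
      pairing (root n 1 j) y = pairing (root n 1 j) y₀ := by
    intro y hy
    obtain ⟨k, hk⟩ := hcon y ((hmem _).1 hy).1 ((hmem _).1 hy).2
    rw [hk, hk₀]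
    by_contra hne
    have hd : (1 : ℝ) ≤ |(k : ℝ) - k₀| := by
      have : k - k₀ ≠ 0 := sub_ne_zero.2 fun e => hne (by rw [e])
      exact_mod_cast Int.one_le_abs this
    -- This point of the segment has an `α_{1j}`-value at distance exactly `1/2` from `k₀`, so not
    -- an integer.
    set t : ℝ := 1 / (2 * |(k : ℝ) - k₀|) with ht
    have ht0 : 0 ≤ t := by positivity
    have ht1 : t ≤ 1 := by
      rw [ht, div_le_one (by linarith)]
      linarith
    have hz := hconv.closure ((hmem _).1 hy₀).1 ((hmem _).1 hy).1 (sub_nonneg.2 ht1) ht0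
      (sub_add_cancel 1 t)
    obtain ⟨l, hl⟩ := hcon _ hz (by
      simp only [map_add, map_smul, smul_eq_mul, ((hmem _).1 hy₀).2, ((hmem _).1 hy).2]
      ring)
    simp only [map_add, map_smul, smul_eq_mul, hk, hk₀] at hl
    have hl' : (l : ℝ) - k₀ = t * (k - k₀) := by rw [← hl]; ring
    have habs : |(l : ℝ) - k₀| = 1 / 2 := by
      rw [hl', abs_mul, abs_of_nonneg ht0, ht]
      have : |(k : ℝ) - k₀| ≠ 0 := by linarith
      field_simp
    have h2' : (2 * |l - k₀| : ℤ) = 1 := by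
      have : (2 * |(l : ℝ) - k₀|) = 1 := by rw [habs]; norm_num
      exact_mod_cast this
    omega
  have hle : affineSpan ℝ (closure R ∩ hyperplane (theta n) (m : ℤ)) ≤
      AffineSubspace.mk' y₀ (LinearMap.ker (pairing (root n 1 j)).toLinearMap) := by
    rw [affineSpan_le]
    intro y hy
    rw [SetLike.mem_coe, AffineSubspace.mem_mk', LinearMap.mem_ker]
    simp [hconst y hy]
  -- A direction inside `H_{θ,m}`: `θ` vanishes on it and `α_{1j}` takes the value `3`.
  let u : V n := ⟨eps n 1 + eps n n - (2 : ℝ) • eps n (j + 1), by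
    have h : ∀ k, k < n → ∑ t : Fin n, (eps n (k + 1)) t = 1 := by
      intro k hk
      rw [Finset.sum_eq_single ⟨k, hk⟩]
      · simp [eps]
      · intro b _ hb
        have : (b : ℕ) ≠ k := fun e => hb (Fin.ext e)
        simp [eps, this]
      · simp
    change ∑ t : Fin n, (eps n 1 + eps n n - (2 : ℝ) • eps n (j + 1)) t = 0
    have hlast := h (n - 1) (by omega)
    rw [show n - 1 + 1 = n by omega] at hlast
    have hfirst := h 0 (by omega)
    rw [zero_add] at hfirst
    simp only [PiLp.sub_apply, PiLp.add_apply, PiLp.smul_apply, smul_eq_mul,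
      Finset.sum_sub_distrib, Finset.sum_add_distrib, ← Finset.mul_sum, hlast, hfirst,
      h j (by omega)]
    norm_num⟩
  have hu0 : pairing (theta n) u = 0 := by
    rw [theta, show (1 : ℕ) = 0 + 1 from rfl, pairing_root (by omega) (by omega)]
    have e1 : ¬ n - 1 = j := by omega
    have e2 : ¬ 0 = j := by omega
    have e3 : n - 1 + 1 = n := by omega
    have e4 : ¬ (1 = n) := by omega
    have e7 : ¬ n - 1 = 0 := by omega
    simp [u, eps, e1, e2, e3, e4, e7]
  have hu1 : pairing (root n 1 j) u ≠ 0 := by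
    rw [show (1 : ℕ) = 0 + 1 from rfl, pairing_root (by omega) (by omega)]
    have e2 : ¬ 0 = j := by omega
    have e4 : ¬ (1 = n) := by omega
    have e5 : ¬ j = 0 := by omega
    have e6 : ¬ j + 1 = n := by omega
    simp [u, eps, e2, e4, e5, e6]
    norm_num
  have hy₀u : y₀ + u ∈ hyperplane (theta n) (m : ℤ) := by
    rw [mem_hyperplane, map_add, hu0, add_zero]
    exact mem_hyperplane.1 hy₀.2
  rw [← hspan] at hy₀u
  have := hle hy₀u
  rw [AffineSubspace.mem_mk', LinearMap.mem_ker] at this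
  exact hu1 (by simpa using this)

/-- The integer is the floor of `α_{1j}` at a facet point where it is not integral. Since `0 ≤ k <
m`, the levels `k`, `k + 1`, `m - 1 - k`, `m - k` all belong to the Shi range, so the bounds extend
to `R`. -/
theorem IsDominantRegion.exists_floor (hR : IsDominantRegion m R)
    (hw : IsWall m (theta n) m R) (ha : a ∈ R) {j : ℕ} (h1 : 1 ≤ j)
    (h2 : j + 1 < n) :
    ∃ k : ℤ, (k : ℝ) < pairing (root n 1 j) a ∧ pairing (root n 1 j) a < k + 1 ∧
      (m - 1 - k : ℝ) < pairing (root n (j + 1) (n - 1)) a ∧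
      pairing (root n (j + 1) (n - 1)) a < m - k := by
  obtain ⟨y, hy, hyθ, hne⟩ := exists_closure_pairing_ne hR.1 hw h1 h2
  have hadd := pairing_root_add (i := 1) (j := j) (k := n - 1) y
  rw [← theta, hyθ] at hadd
  have p1 := hR.pairing_closure_nonneg hy le_rfl h1 (by omega)
  have p2 := hR.pairing_closure_nonneg hy (show 1 ≤ j + 1 by omega) (show j + 1 ≤ n - 1 by omega)
    (by omega)
  set k := ⌊pairing (root n 1 j) y⌋ with hk
  have hk0 : 0 ≤ k := Int.floor_nonneg.2 p1
  have hklt : (k : ℝ) < pairing (root n 1 j) y :=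
    lt_of_le_of_ne (Int.floor_le _) (hne k).symm
  have hklt' : pairing (root n 1 j) y < k + 1 := Int.lt_floor_add_one _
  have hkm : k < m := by
    have : (k : ℝ) < (m : ℤ) := by push_cast; linarith
    exact_mod_cast this
  refine ⟨k, ?_, ?_, ?_, ?_⟩
  · exact hR.1.lt_pairing_of_closure ha hy le_rfl h1 (by omega) (by omega) hkm.le hklt
  · have := hR.1.pairing_lt_of_closure (k := k + 1) ha hy le_rfl h1 (by omega) (by omega)
      (by omega) (by push_cast; exact hklt')
    push_cast at this
    exact this
  · have := hR.1.lt_pairing_of_closure (k := m - 1 - k) ha hy (show 1 ≤ j + 1 by omega)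
      (show j + 1 ≤ n - 1 by omega) (by omega) (by omega) (by omega) (by push_cast; linarith)
    push_cast at this
    exact this
  · have := hR.1.pairing_lt_of_closure (k := m - k) ha hy (show 1 ≤ j + 1 by omega)
      (show j + 1 ≤ n - 1 by omega) (by omega) (by omega) (by omega) (by push_cast; linarith)
    push_cast at this
    exact this

/-! ### Shi coordinates -/

theorem coreCoord_lt (ha : a ∈ Psi n lam) {i j : ℕ} (h1 : 1 ≤ i) (h2 : i ≤ j) (h3 : j < n) :
    (coreCoord n lam i j : ℝ) < pairing (root n i j) a ∧
      pairing (root n i j) a < coreCoord n lam i j + 1 := by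
  rw [← pairing_apply]
  exact ha i j h1 h2 h3

theorem coreCoord_eq_of_lt (ha : a ∈ Psi n lam) {i j : ℕ} (h1 : 1 ≤ i) (h2 : i ≤ j) (h3 : j < n)
    {k : ℤ} (hk : (k : ℝ) < pairing (root n i j) a) (hk' : pairing (root n i j) a < k + 1) :
    coreCoord n lam i j = k := by
  obtain ⟨h, h'⟩ := coreCoord_lt ha h1 h2 h3
  have e1 : (coreCoord n lam i j : ℝ) < (k + 1 : ℤ) := by push_cast; linarith
  have e2 : (k : ℝ) < (coreCoord n lam i j + 1 : ℤ) := by push_cast; linarith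
  have := Int.cast_lt.1 e1
  have := Int.cast_lt.1 e2
  omega

theorem le_coreCoord_iff (ha : a ∈ Psi n lam) {i j : ℕ} (h1 : 1 ≤ i) (h2 : i ≤ j) (h3 : j < n)
    {k : ℤ} :
    k ≤ coreCoord n lam i j ↔ (k : ℝ) ≤ pairing (root n i j) a := by
  obtain ⟨h, h'⟩ := coreCoord_lt ha h1 h2 h3
  constructor
  · intro hle
    exact (Int.cast_le.2 hle).trans h.le
  · intro hle
    have e : (k : ℝ) < (coreCoord n lam i j + 1 : ℤ) := by push_cast; linarith
    have := Int.cast_lt.1 e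
    omega

theorem separates_iff_le_coreCoord (hR : IsRegionOf (shiArrangement n m) R) (ha : a ∈ R)
    (ha' : a ∈ Psi n lam) {i j : ℕ} (h1 : 1 ≤ i) (h2 : i ≤ j) (h3 : j < n) {k : ℤ}
    (hk : 1 ≤ k) (hk' : k ≤ m) :
    Separates (root n i j) k R (fundamentalAlcove n) ↔ k ≤ coreCoord n lam i j := by
  rw [separates_iff h1 h2 h3 hk, hR.subset_upperHalf_iff ha h1 h2 h3 (by omega) hk',
    le_coreCoord_iff ha' h1 h2 h3]

/-- Each `j` contributes the `k` in `[1, f j]`; the cutoff `k ≤ m` removes nothing because `f j ≤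
m`. -/
theorem ncard_pairs_le {f : ℕ → ℤ} (hf : ∀ j, 1 ≤ j → j < n → 0 ≤ f j ∧ f j ≤ m)
    {S : Set (ℕ × ℕ)} (hS : ∀ b, b ∈ S ↔ 1 ≤ b.1 ∧ b.1 < n ∧ 1 ≤ b.2 ∧ b.2 ≤ m ∧
      (b.2 : ℤ) ≤ f b.1) :
    (S.ncard : ℤ) = ∑ j ∈ Ico 1 n, f j := by
  have e : S = ((Ico 1 n).biUnion fun j => (Icc 1 (f j).toNat).map
      ⟨fun k => (j, k), Prod.mk_right_injective j⟩ : Finset (ℕ × ℕ)) := by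
    ext ⟨j, k⟩
    simp only [hS, coe_biUnion, Set.mem_iUnion, mem_coe, mem_map, mem_Icc, mem_Ico,
      Function.Embedding.coeFn_mk, Prod.mk.injEq]
    constructor
    · rintro ⟨h1, h2, h3, -, h5⟩
      exact ⟨j, ⟨h1, h2⟩, k, ⟨h3, by omega⟩, rfl, rfl⟩
    · rintro ⟨j', ⟨h1, h2⟩, k', ⟨h3, h4⟩, rfl, rfl⟩
      have := hf j' h1 h2
      exact ⟨h1, h2, h3, by omega, by omega⟩
  rw [e, Set.ncard_coe_finset, card_biUnion, Nat.cast_sum]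
  · refine sum_congr rfl fun j hj => ?_
    have := hf j (mem_Ico.1 hj).1 (mem_Ico.1 hj).2
    simp [this.1]
  · intro x _ y _ hxy
    refine disjoint_left.2 fun b hb hb' => ?_
    simp only [mem_map, Function.Embedding.coeFn_mk] at hb hb'
    obtain ⟨k, -, rfl⟩ := hb
    obtain ⟨k', -, h⟩ := hb'
    exact hxy (congrArg Prod.fst h).symm

/-! ### The case `n = 2` -/

theorem posRoots_two : posRoots 2 = {root 2 1 1} := by
  ext α
  constructor
  · rintro ⟨i, j, h1, h2, h3, rfl⟩
    obtain rfl : i = 1 := by omega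
    obtain rfl : j = 1 := by omega
    rfl
  · rintro rfl
    exact root_mem_posRoots le_rfl le_rfl (by norm_num)

theorem subset_compl_sUnion_shiArrangement :
    (⋃₀ affineArrangement n)ᶜ ⊆ (⋃₀ shiArrangement n m)ᶜ := by
  refine Set.compl_subset_compl.2 (Set.sUnion_mono ?_)
  rintro H ⟨α, hα, k, _, _, rfl⟩
  exact ⟨α, hα, k, rfl⟩

/-- In rank one the minimal alcove of the unbounded dominant region is the lowest one. -/
theorem coreCoord_le_of_isMinimalAlcove {R : Set (V 2)}
    (hR : IsRegionOf (shiArrangement 2 m) R)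
    (hPsi : IsMinimalAlcove R (Psi 2 lam)) (hK : (m : ℤ) ≤ coreCoord 2 lam 1 1) :
    coreCoord 2 lam 1 1 ≤ m := by
  obtain ⟨hA, hAR, hmin⟩ := hPsi
  obtain ⟨a, ha⟩ := hA.nonempty
  -- A point of the alcove `m < α < m + 1`, the competitor in the minimality condition.
  set x : V 2 := (m + 1 / 2 : ℝ) • weylVector 2 with hx
  have hpx : pairing (root 2 1 1) x = m + 1 / 2 := by
    rw [hx, map_smul, pairing_weylVector le_rfl le_rfl (by norm_num)]
    simp
  have hxmem : x ∈ (⋃₀ affineArrangement 2)ᶜ := by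
    rintro ⟨H, ⟨α, hα, k, rfl⟩, hxH⟩
    rw [posRoots_two] at hα
    rw [Set.mem_singleton_iff.1 hα, mem_hyperplane, hpx] at hxH
    have : (2 * m + 1 : ℤ) = 2 * k := by
      have : (2 * m + 1 : ℝ) = 2 * k := by linarith
      exact_mod_cast this
    omega
  have hpa : (m : ℝ) < pairing (root 2 1 1) a := by
    have hK' : (m : ℝ) ≤ coreCoord 2 lam 1 1 := by exact_mod_cast hK
    exact hK'.trans_lt (coreCoord_lt ha le_rfl le_rfl (by norm_num)).1
  have hRcomp : R = connectedComponentIn (⋃₀ shiArrangement 2 m)ᶜ x := by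
    have haS := (hR.eq_cell exists_hyperplane_of_mem_shiArrangement (hAR ha))
    have hRa : R = connectedComponentIn (⋃₀ shiArrangement 2 m)ᶜ a := by
      rw [connectedComponentIn_eq_cell exists_hyperplane_of_mem_shiArrangement haS.1]
      exact haS.2
    have hconv : Convex ℝ {v : V 2 | (m : ℝ) < pairing (root 2 1 1) v} :=
      convex_halfSpace_gt (pairing (root 2 1 1)).toLinearMap.isLinear _
    have hsub : {v : V 2 | (m : ℝ) < pairing (root 2 1 1) v} ⊆ (⋃₀ shiArrangement 2 m)ᶜ := by
      rintro v hv ⟨H, ⟨α, hα, k, -, hk, rfl⟩, hvH⟩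
      rw [posRoots_two] at hα
      rw [Set.mem_singleton_iff.1 hα, mem_hyperplane] at hvH
      have hk' : (k : ℝ) ≤ m := by exact_mod_cast hk
      have hv' : (m : ℝ) < pairing (root 2 1 1) v := hv
      linarith
    rw [hRa]
    refine connectedComponentIn_eq (hconv.isPreconnected.subset_connectedComponentIn hpa hsub ?_)
    change (m : ℝ) < pairing (root 2 1 1) x
    rw [hpx]
    linarith
  have hcard := hmin (connectedComponentIn (⋃₀ affineArrangement 2)ᶜ x) ⟨x, hxmem, rfl⟩
    (hRcomp ▸ connectedComponentIn_mono x subset_compl_sUnion_shiArrangement)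
  let e : ℤ ↪ EuclideanSpace ℝ (Fin 2) × ℤ := ⟨fun k => (root 2 1 1, k), Prod.mk_right_injective _⟩
  -- With `K` the coordinate of the given alcove, at least the levels `1, …, K` separate it and at
  -- most `1, …, m` separate the competitor; minimality yields `K ≤ m`.
  have hlow : (((Icc 1 (coreCoord 2 lam 1 1)).map e : Finset _) : Set _) ⊆
      separatingSet (Psi 2 lam) := by
    intro b hb
    obtain ⟨k, hk, rfl⟩ := mem_map.1 (mem_coe.1 hb)
    rw [mem_Icc] at hk
    refine ⟨root_mem_posRoots le_rfl le_rfl (by norm_num),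
      (separates_iff le_rfl le_rfl (by norm_num) hk.1 _).2 fun v hv => mem_upperHalf.2 ?_⟩
    exact (le_coreCoord_iff hv le_rfl le_rfl (by norm_num)).1 hk.2
  have hup : separatingSet (connectedComponentIn (⋃₀ affineArrangement 2)ᶜ x) ⊆
      ((Icc 1 (m : ℤ)).map e : Finset _) := by
    rintro ⟨α, k⟩ ⟨hα, hs⟩
    rw [posRoots_two] at hα
    obtain rfl : α = root 2 1 1 := Set.mem_singleton_iff.1 hα
    refine mem_coe.2 (mem_map.2 ⟨k, mem_Icc.2 ?_, rfl⟩)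
    have hxB := mem_connectedComponentIn hxmem
    obtain ⟨v, hv, hval⟩ := exists_mem_fundamentalAlcove 2
    obtain ⟨hv0, hv1⟩ := hval 1 1 le_rfl le_rfl (by norm_num)
    rcases hs with ⟨h1, h2⟩ | ⟨h1, h2⟩
    · have h1 := mem_upperHalf.1 (h1 hxB)
      have h2 := mem_lowerHalf.1 (h2 hv)
      rw [hpx] at h1
      have e1 : (0 : ℝ) < k := hv0.trans_le h2
      have e2 : (k : ℝ) < (m + 1 : ℤ) := by push_cast; linarith
      have := Int.cast_pos.1 e1
      have := Int.cast_lt.1 e2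
      omega
    · have h1 := mem_lowerHalf.1 (h1 hxB)
      have h2 := mem_upperHalf.1 (h2 hv)
      rw [hpx] at h1
      have : (0 : ℝ) ≤ m := Nat.cast_nonneg m
      have e1 : (k : ℝ) < (1 : ℤ) := by push_cast; linarith
      have e2 : (0 : ℝ) < k := by linarith
      have := Int.cast_pos.1 e2
      have := Int.cast_lt.1 e1
      omega
  have := (Set.encard_le_encard hlow).trans (hcard.trans (Set.encard_le_encard hup))
  rw [Set.encard_coe_eq_coe_finsetCard, Set.encard_coe_eq_coe_finsetCard, card_map, card_map,
    Int.card_Icc, Int.card_Icc, Nat.cast_le] at this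
  omega

/-! ### The alcove of the core -/

theorem IsDominantRegion.coreCoord_add (hR : IsDominantRegion m R)
    (hw : IsWall m (theta n) m R) (ha : a ∈ R) (ha' : a ∈ Psi n lam) {j : ℕ} (h1 : 1 ≤ j)
    (h2 : j + 1 < n) :
    coreCoord n lam 1 j + coreCoord n lam (j + 1) (n - 1) = m - 1 := by
  obtain ⟨k, k1, k2, k3, k4⟩ := hR.exists_floor hw ha h1 h2
  rw [coreCoord_eq_of_lt ha' le_rfl h1 (by omega) k1 k2,
    coreCoord_eq_of_lt (k := m - 1 - k) ha' (by omega) (by omega) (by omega)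
      (by push_cast; exact k3) (by push_cast; linarith)]
  ring

/-- Separation gives `≥`. For `n ≥ 3`, splitting `θ` as `α_{11} + α_{2,n-1}` bounds it by `(k + 1) +
(m - k) = m + 1` strictly; for `n = 2` minimality is needed. -/
theorem coreCoord_theta (hn : 2 ≤ n) (hm : 1 ≤ m) (hR : IsDominantRegion m R)
    (hPsi : IsMinimalAlcove R (Psi n lam)) (hsep : IsSeparatingWall m (theta n) (m : ℤ) R) :
    coreCoord n lam 1 (n - 1) = m := by
  obtain ⟨a, ha⟩ := hPsi.1.nonempty
  have hge : (m : ℤ) ≤ coreCoord n lam 1 (n - 1) :=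
    (separates_iff_le_coreCoord hR.1 (hPsi.2.1 ha) ha le_rfl (by omega) (by omega)
      (by exact_mod_cast hm) le_rfl).1 hsep.2
  rcases Nat.eq_or_lt_of_le hn with rfl | hn3
  · exact le_antisymm (coreCoord_le_of_isMinimalAlcove hR.1 hPsi hge) hge
  · obtain ⟨k, -, k2, -, k4⟩ := hR.exists_floor hsep.1 (hPsi.2.1 ha) le_rfl
      (show 1 + 1 < n by omega)
    have hlt := (coreCoord_lt ha le_rfl (show 1 ≤ n - 1 by omega) (by omega)).1
    rw [← pairing_root_add (j := 1)] at hlt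
    have e : (coreCoord n lam 1 (n - 1) : ℝ) < (m + 1 : ℤ) := by push_cast; linarith
    have := Int.cast_lt.1 e
    omega

/-! ### Largest part and sums over runners -/

/-- The largest bead `λ_1 + ℓ - 1` equals `(m - 1)n + 1`. The latter is a bead since `b_1 = m`, and
the first gap on the runner of any bead is at least `n` above it but at most `p_n = mn + 1`. -/
theorem IsCore.firstPart_eq (hlam : IsCore n lam) (hn : 2 ≤ n) (hm : 1 ≤ m)
    (hp : sortedGap n lam n = m * n + 1) (hb : levelNumber n lam 1 = m) :
    (firstPart lam : ℤ) = m * n + 2 - n - length lam := by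
  have hn0 : 0 < n := by omega
  have hmn : (n : ℤ) ≤ m * n := by
    have : (1 : ℤ) ≤ m := by exact_mod_cast hm
    nlinarith
  have hbead : ((m - 1 : ℤ)) * n + (1 : ℕ) ∈ beads lam := by
    rw [← hlam.lt_levelNumber_iff (by omega), hb]
    omega
  have e : ((m - 1 : ℤ)) * n = m * n - n := by ring
  have hle := le_of_mem_beads hbead
  -- As `m ≥ 1`, the bead `(m - 1)n + 1` is positive, so the diagram is nonempty and row `0`
  -- provides a bead.
  have hrow : 0 < lam.colLen 0 := by
    rcases mem_beads_iff.1 hbead with h | ⟨k, hk, -⟩ <;> omega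
  obtain ⟨w, hw⟩ : ∃ w : ℕ, (w : ℤ) = lam.rowLen 0 + lam.colLen 0 - 1 :=
    ⟨lam.rowLen 0 + lam.colLen 0 - 1, by omega⟩
  have hwb : ((w / n : ℕ) : ℤ) * n + (w % n : ℕ) ∈ beads lam := by
    refine mem_beads_iff.2 (Or.inr ⟨0, hrow, ?_⟩)
    have : ((w / n * n + w % n : ℕ) : ℤ) = w := by rw [Nat.div_add_mod']
    push_cast at this ⊢
    omega
  have hlt := (hlam.lt_levelNumber_iff (Nat.mod_lt w hn0)).2 hwb
  have hgap := gapEntry_le_sortedGap_last (lam := lam) (⟨w % n, Nat.mod_lt w hn0⟩ : Fin n)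
  rw [hp, gapEntry] at hgap
  simp only at hgap
  have hwd : ((w / n : ℕ) : ℤ) * n + (w % n : ℕ) = w := by
    have : ((w / n * n + w % n : ℕ) : ℤ) = w := by rw [Nat.div_add_mod']
    push_cast at this ⊢
    exact this
  have hmul : (((w / n : ℕ) : ℤ) + 1) * n ≤ levelNumber n lam (w % n) * n :=
    mul_le_mul_of_nonneg_right (by omega) (by omega)
  rw [add_mul, one_mul] at hmul
  rw [length_eq_colLen, firstPart]
  omega

theorem IsCore.sum_levelNumber_eq (hlam : IsCore n lam) (hn : 2 ≤ n)
    (hb : levelNumber n lam 1 = m) :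
    (m : ℤ) + ∑ i ∈ Ico 2 n, levelNumber n lam i = length lam := by
  rw [← hlam.sum_levelNumber (by omega), range_eq_Ico,
    sum_eq_sum_Ico_succ_bot (show 0 < n by omega),
    sum_eq_sum_Ico_succ_bot (show 0 + 1 < n by omega), hlam.levelNumber_zero (by omega), zero_add, zero_add,
    one_add_one_eq_two, hb]

/-- Runner `0` contributes `m`, runner `1` contributes `m - b_1 = 0`, and each runner `t ≥ 2`
contributes `m - 1 - b_t`. The added term at `i = n` is `0`. -/
theorem IsCore.sum_coreCoord_last (hlam : IsCore n lam) (hn : 2 ≤ n)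
    (hp : sortedGap n lam n = m * n + 1) (hb : levelNumber n lam 1 = m) :
    ∑ i ∈ Ico 1 n, coreCoord n lam i (n - 1) =
      m + ∑ i ∈ Ico 2 n, ((m : ℤ) - 1 - levelNumber n lam i) := by
  have hend : coreCoord n lam n (n - 1) = 0 := by
    rw [coreCoord_eq, Nat.sub_add_cancel (by omega), sub_self, Int.zero_ediv]
  have h1 : ∑ i ∈ Ico 1 n, coreCoord n lam i (n - 1) =
      ∑ s : Fin n, coreCoord n lam (s + 1) (n - 1) := by
    rw [← Finset.sum_range fun s => coreCoord n lam (s + 1) (n - 1), range_eq_Ico,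
      sum_Ico_add' (fun i => coreCoord n lam i (n - 1)) 0 n 1, zero_add,
      sum_Ico_succ_top (by omega), hend, add_zero]
  rw [h1]
  simp_rw [coreCoord_last hn hp]
  rw [Equiv.sum_comp (Tuple.sort (gapEntry n lam))
    fun t : Fin n => (m - levelNumber n lam t - if 2 ≤ (t : ℕ) then 1 else 0 : ℤ),
    ← Finset.sum_range fun t => (m - levelNumber n lam t - if 2 ≤ t then 1 else 0 : ℤ),
    range_eq_Ico, sum_eq_sum_Ico_succ_bot (by omega), sum_eq_sum_Ico_succ_bot (by omega),
    hlam.levelNumber_zero (by omega), hb]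
  simp only [zero_add, one_add_one_eq_two]
  rw [sum_congr rfl (g := fun i => (m : ℤ) - 1 - levelNumber n lam i)]
  · simp
  · intro i hi
    rw [if_pos (mem_Ico.1 hi).1]
    ring

end Shi

end

/-! ### Assembly of the four equalities -/

theorem mainTheorem9 (n m : ℕ) (hn : 2 ≤ n) (hm : 1 ≤ m)
    (lam : YoungDiagram) (hlam : Shi.IsCore n lam)
    (R : Set (Shi.V n)) (hR : Shi.IsDominantRegion m R)
    (hPsi : Shi.IsMinimalAlcove R (Shi.Psi n lam))
    (hsep : Shi.IsSeparatingWall m (Shi.theta n) (m : ℤ) R) :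
    ((Shi.rStat m R : ℤ) = m + ∑ i ∈ Finset.Ico 2 n, Shi.levelNumber n lam i ∧
      (m : ℤ) + ∑ i ∈ Finset.Ico 2 n, Shi.levelNumber n lam i = Shi.length lam) ∧
    ((Shi.cStat m R : ℤ) =
        m + ∑ i ∈ Finset.Ico 2 n, ((m : ℤ) - 1 - Shi.levelNumber n lam i) ∧
      (m : ℤ) + ∑ i ∈ Finset.Ico 2 n, ((m : ℤ) - 1 - Shi.levelNumber n lam i) =
        Shi.firstPart lam) := by
  obtain ⟨a, ha⟩ := hPsi.1.nonempty
  have haR := hPsi.2.1 ha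
  have hθ := Shi.coreCoord_theta hn hm hR hPsi hsep
  obtain ⟨hp, hb⟩ := hlam.sortedGap_last hn hθ fun j h1 h2 => hR.coreCoord_add hsep.1 haR ha h1 h2
  have hle : ∀ i j, 1 ≤ i → i ≤ j → j < n →
      0 ≤ Shi.coreCoord n lam i j ∧ Shi.coreCoord n lam i j ≤ m := by
    intro i j h1 h2 h3
    have hdom := hR.2 haR
    constructor
    · have h := (Shi.coreCoord_lt ha h1 h2 h3).2
      have h0 := Shi.pairing_root_nonneg hdom h1 h2 h3
      have e : (0 : ℝ) < (Shi.coreCoord n lam i j + 1 : ℤ) := by push_cast; linarith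
      have := Int.cast_pos.1 e
      omega
    -- The upper bound is `k_{ij} ≤ k_θ = m`, since `θ` dominates every positive root on the
    -- dominant chamber.
    · rw [← hθ, Shi.le_coreCoord_iff ha le_rfl (by omega) (by omega)]
      exact (Shi.coreCoord_lt ha h1 h2 h3).1.le.trans (Shi.pairing_root_le_theta hdom h1 h2 h3)
  have hlen := hlam.sum_levelNumber_eq hn hb
  have hr : (Shi.rStat m R : ℤ) = ∑ j ∈ Finset.Ico 1 n, Shi.coreCoord n lam 1 j := by
    refine Shi.ncard_pairs_le (fun j h1 h2 => hle 1 j le_rfl h1 h2) fun b => ?_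
    refine and_congr_right fun h1 => and_congr_right fun h2 => and_congr_right fun h3 =>
      and_congr_right fun h4 => ?_
    exact Shi.separates_iff_le_coreCoord hR.1 haR ha le_rfl h1 h2 (by exact_mod_cast h3)
      (by exact_mod_cast h4)
  have hc : (Shi.cStat m R : ℤ) = ∑ i ∈ Finset.Ico 1 n, Shi.coreCoord n lam i (n - 1) := by
    refine Shi.ncard_pairs_le (fun i h1 h2 => hle i (n - 1) h1 (by omega) (by omega)) fun b => ?_
    refine and_congr_right fun h1 => and_congr_right fun h2 => and_congr_right fun h3 =>
      and_congr_right fun h4 => ?_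
    exact Shi.separates_iff_le_coreCoord hR.1 haR ha h1 (by omega) (by omega)
      (by exact_mod_cast h3) (by exact_mod_cast h4)
  have hsum : ∑ i ∈ Finset.Ico 2 n, ((m : ℤ) - 1 - Shi.levelNumber n lam i) =
      (n - 2) * (m - 1) - ∑ i ∈ Finset.Ico 2 n, Shi.levelNumber n lam i := by
    rw [Finset.sum_sub_distrib, Finset.sum_const, Nat.card_Ico, nsmul_eq_mul, Nat.cast_sub hn]
    push_cast
    ring
  refine ⟨⟨?_, hlen⟩, ?_, ?_⟩
  · rw [hr, hlam.sum_coreCoord_one (by omega), hlam.sum_levelNumber (by omega), hlen]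
  · rw [hc, hlam.sum_coreCoord_last hn hp hb]
  · rw [hlam.firstPart_eq hn hm hp hb, hsum, ← hlen]
    ring
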